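/- Let $M$ be a closed (that is, compact, Hausdorff, without boundary) smooth manifold of dimension $n\ge 0$, let $T^k=(S^1)^k$ be the $k$-dimensional torus ($k\ge 0$), and let $T^k$ act smoothly on $M$. For $x\in M$ let $\mathrm{ev}\colon T^k\to M$, $\mathrm{ev}(t)=t\cdot x$, be the orbit map at $x$, and suppose that the action is homologically injective, i.e. that for some $x\in M$ the induced homomorphism on singular homology $$\mathrm{ev}_*\colon H_1(T^k;\mathbb Z)=\mathbb Z^k\longrightarrow H_1(M;\mathbb Z)$$ is injective. Let $b_j=\operatorname{rank}H_j(M;\mathbb Z)$ denote the $j$-th Betti number of $M$. Then $$\binom{k}{j}\le b_j\qquad\text{for all } j\ge 0 ,$$ and the inequality of the Halperin--Carlsson conjecture holds: $$2^k\le \sum_{j=0}^{n} b_j .$$ -/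

import Mathlib

open scoped Manifold ContDiff

universe u

noncomputable section

namespace TorusAction

/-- The `k`-dimensional torus `T^k = (S¹)^k`, a group under pointwise multiplication, with the
product topology and the product smooth structure. -/
abbrev Torus (k : ℕ) : Type := Fin k → Circle

/-- The model with corners of the product smooth structure on `Torus k`. -/
abbrev torusModel (k : ℕ) :
    ModelWithCorners ℝ (Fin k → EuclideanSpace ℝ (Fin 1))
      (ModelPi fun _ : Fin k => EuclideanSpace ℝ (Fin 1)) :=
  ModelWithCorners.pi fun _ : Fin k => 𝓡 1

/-- Singular homology with integer coefficients, as a functor on topological spaces in the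
universe `u` (the coefficient group is `ℤ`, lifted to that universe). -/
def integralHomology (j : ℕ) : CategoryTheory.Functor TopCat.{u} (ModuleCat.{u} ℤ) :=
  (AlgebraicTopology.singularHomologyFunctor (ModuleCat.{u} ℤ) j).obj
    (ModuleCat.of ℤ (ULift.{u} ℤ))

/-- The `j`-th Betti number `b_j(X) = rank H_j(X; ℤ)`, the rank being the cardinal number
`Module.rank` (so that no value is assigned by convention in the case of infinite rank). -/
def bettiNumber (X : Type u) [TopologicalSpace X] (j : ℕ) : Cardinal.{u} :=
  Module.rank ℤ ((integralHomology j).obj (TopCat.of X))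

/-- The orbit map `ev : T^k → M`, `ev t = t • x`, at the point `x` (the torus is lifted to the
universe of `M`). -/
def orbitMap (k : ℕ) {M : Type u} [TopologicalSpace M] [MulAction (Torus k) M]
    [ContinuousSMul (Torus k) M] (x : M) : C(ULift.{u} (Torus k), M) where
  toFun t := t.down • x
  continuous_toFun := by fun_prop

/-- The action of `T^k` on `M` is homologically injective (with respect to the base point `x`):
the map `ev_* : H_1(T^k; ℤ) → H_1(M; ℤ)` induced by the orbit map at `x` is injective. -/
def HomologicallyInjectiveAt (k : ℕ) {M : Type u} [TopologicalSpace M] [MulAction (Torus k) M]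
    [ContinuousSMul (Torus k) M] (x : M) : Prop :=
  Function.Injective ((integralHomology.{u} 1).map (TopCat.ofHom (orbitMap k x)))

end TorusAction

end

/-! Everything rests on pairing real cocycles on `M` with images of tori. The winding number of the
`i`-th coordinate is a homomorphism `H_1(T^k) → ℝ`. Since `ev_*` is injective and `ℝ` is divisible,
it extends over `H_1(M)`, giving a 1-cocycle `c i` on `M` with prescribed values on images of loops
of the torus (`exists_isCocycle_winding`). For each `j`-subset of the coordinates, take the cup
product of the corresponding `c i` and the image of the fundamental cycle of the corresponding
coordinate subtorus. The pairing of two subsets is a determinant of Kronecker deltas, so these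
cycles and cocycles are dual families of size `k.choose j` (`choose_le_bettiNumber`).

The sum inequality follows by adding these bounds up to `j = n`, provided that `k ≤ n`
(`HomologicallyInjectiveAt.le_dim`). If `k > n`, the derivative of the orbit map has a kernel, so a
one-parameter subgroup fixes `x`. Some nonzero lattice direction lies so close to that subgroup that
its orbit loop through `x` stays in a chart ball. The loop is then null-homotopic, yet some `c i` is
nonzero on it. -/

noncomputable section

open CategoryTheory Limits Opposite Simplicial

/-! ### Real cocycles, their extension, and lower bounds for the rank of homology -/

namespace SSet

/-- The additive group `ℤ`, as a coefficient module in the universe `u`. -/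
abbrev intCoeff : ModuleCat.{u} ℤ := ModuleCat.of ℤ (ULift.{u} ℤ)

/-- The additive group `ℝ`, as a `ℤ`-module in the universe `u`. -/
abbrev realCoeff : ModuleCat.{u} ℤ := ModuleCat.of ℤ (ULift.{u} ℝ)

/-- The homomorphism `ℤ → ℝ` sending `1` to `r`. -/
def intToReal (r : ℝ) : intCoeff.{u} ⟶ realCoeff.{u} :=
  ModuleCat.ofHom
    ((LinearMap.toSpanSingleton ℤ (ULift.{u} ℝ) ⟨r⟩).comp ULift.moduleEquiv.toLinearMap)

lemma intToReal_apply (r : ℝ) (m : ULift.{u} ℤ) :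
    (intToReal.{u} r).hom m = ⟨m.down * r⟩ := by
  apply ULift.ext
  simp [intToReal, LinearMap.toSpanSingleton]

/-- The real number by which a homomorphism `ℤ → ℝ` multiplies. -/
def evalOne (f : intCoeff.{u} ⟶ realCoeff.{u}) : ℝ := (f.hom (ULift.up 1)).down

@[simp]
lemma evalOne_intToReal (r : ℝ) : evalOne (intToReal.{u} r) = r := by
  rw [evalOne, intToReal_apply]
  simp

@[simp]
lemma intToReal_evalOne (f : intCoeff.{u} ⟶ realCoeff.{u}) : intToReal (evalOne f) = f := by
  ext m
  have h : m = m.down • (ULift.up 1 : ULift.{u} ℤ) := by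
    apply ULift.ext; simp
  rw [h, map_zsmul, map_zsmul, intToReal_apply]
  simp [evalOne]

lemma evalOne_injective : Function.Injective evalOne.{u} := fun f g h => by
  rw [← intToReal_evalOne f, h, intToReal_evalOne]

@[simp]
lemma evalOne_zero : evalOne (0 : intCoeff.{u} ⟶ realCoeff.{u}) = 0 := rfl

@[simp]
lemma evalOne_add (f g : intCoeff.{u} ⟶ realCoeff.{u}) :
    evalOne (f + g) = evalOne f + evalOne g := rfl

/-- `evalOne` as an additive homomorphism. -/
def evalOneHom : (intCoeff.{u} ⟶ realCoeff.{u}) →+ ℝ where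
  toFun := evalOne
  map_zero' := evalOne_zero
  map_add' := evalOne_add

lemma evalOne_sum_zsmul {ι : Type*} (s : Finset ι) (m : ι → ℤ)
    (f : ι → (intCoeff.{u} ⟶ realCoeff.{u})) :
    evalOne (∑ i ∈ s, m i • f i) = ∑ i ∈ s, m i * evalOne (f i) := by
  change evalOneHom _ = _
  simp only [map_sum, map_zsmul, zsmul_eq_mul]
  rfl

/-- Divisible groups are injective by Baer's criterion; this is what allows homomorphisms on `H_1`
to be extended. -/
instance : Injective realCoeff.{u} := by
  have : DivisibleBy (ULift.{u} ℝ) ℤ :=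
    { div := fun r m => ⟨r.down / m⟩
      div_zero := fun r => by apply ULift.ext; simp
      div_cancel := fun {m} r hm => by
        apply ULift.ext
        have : (m : ℝ) ≠ 0 := by exact_mod_cast hm
        simp [mul_div_cancel₀ _ this] }
  exact Module.injective_object_of_injective_module
    (inj := (Module.Baer.of_divisible (ULift.{u} ℝ)).injective)

variable (X : SSet.{u})

/-- The homomorphism on `n`-chains given by a real valued function on the `n`-simplices. -/
def cochainHom {n : ℕ} (c : X _⦋n⦌ → ℝ) : (X.chainComplex intCoeff.{u}).X n ⟶ realCoeff.{u} :=
  (X.isColimitChainComplexXCofan intCoeff.{u} n).desc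
    (Cofan.mk realCoeff.{u} fun σ => intToReal (c σ))

lemma ι_cochainHom {n : ℕ} (c : X _⦋n⦌ → ℝ) (σ : X _⦋n⦌) :
    X.ιChainComplex σ ≫ X.cochainHom c = intToReal (c σ) :=
  (X.isColimitChainComplexXCofan intCoeff.{u} n).fac
    (Cofan.mk realCoeff.{u} fun σ => intToReal (c σ)) ⟨σ⟩

@[simp]
lemma evalOne_ι_cochainHom {n : ℕ} (c : X _⦋n⦌ → ℝ) (σ : X _⦋n⦌) :
    evalOne (X.ιChainComplex σ ≫ X.cochainHom c) = c σ := by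
  rw [ι_cochainHom, evalOne_intToReal]

/-- A real valued function on the `n`-simplices is a cocycle if it vanishes on boundaries. -/
def IsCocycle {n : ℕ} (c : X _⦋n⦌ → ℝ) : Prop :=
  ∀ τ : X _⦋n + 1⦌, ∑ i : Fin (n + 2), (-1) ^ i.val * c (X.δ i τ) = 0

variable {X}

lemma evalOne_d {n : ℕ} (φ : (X.chainComplex intCoeff.{u}).X n ⟶ realCoeff.{u})
    (τ : X _⦋n + 1⦌) :
    evalOne (X.ιChainComplex τ ≫ (X.chainComplex intCoeff.{u}).d (n + 1) n ≫ φ) =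
      ∑ i : Fin (n + 2), (-1) ^ i.val * evalOne (X.ιChainComplex (X.δ i τ) ≫ φ) := by
  rw [ιChainComplex_d_assoc, Preadditive.sum_comp]
  simp only [Preadditive.zsmul_comp]
  rw [evalOne_sum_zsmul]
  simp

lemma IsCocycle.d_cochainHom {n : ℕ} {c : X _⦋n⦌ → ℝ} (hc : X.IsCocycle c) :
    (X.chainComplex intCoeff.{u}).d (n + 1) n ≫ X.cochainHom c = 0 := by
  refine chainComplex_hom_ext fun τ => ?_
  apply evalOne_injective
  rw [evalOne_d]
  simpa using hc τ

/-- The class of `c` is extended from `H_1(X)` to `H_1(Y)`, and then to chains modulo boundaries.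
Only homology classes are controlled, so agreement with `c` is claimed just for edges that are
cycles. -/
lemma exists_isCocycle_extension {Y : SSet.{u}} (f : X ⟶ Y)
    [Mono (SSet.homologyMap f intCoeff.{u} 1)] {c : X _⦋1⦌ → ℝ} (hc : X.IsCocycle c) :
    ∃ c' : Y _⦋1⦌ → ℝ, Y.IsCocycle c' ∧
      ∀ σ : X _⦋1⦌, X.δ 0 σ = X.δ 1 σ → c' (f.app _ σ) = c σ := by
  let K := X.chainComplex intCoeff.{u}
  let L := Y.chainComplex intCoeff.{u}
  let φ : K.opcycles 1 ⟶ realCoeff.{u} :=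
    K.descOpcycles (X.cochainHom c) 2 (ChainComplex.prev ℕ 1) hc.d_cochainHom
  let g : L.homology 1 ⟶ realCoeff.{u} :=
    Injective.factorThru (K.homologyι 1 ≫ φ) (SSet.homologyMap f intCoeff.{u} 1)
  let h : L.opcycles 1 ⟶ realCoeff.{u} := Injective.factorThru g (L.homologyι 1)
  refine ⟨fun σ => evalOne (Y.ιChainComplex σ ≫ L.pOpcycles 1 ≫ h), fun τ => ?_, fun σ hσ => ?_⟩
  · rw [← evalOne_d, HomologicalComplex.d_pOpcycles_assoc]
    simp
  · have hd : X.ιChainComplex σ ≫ K.d 1 0 = 0 := by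
      rw [ιChainComplex_d]
      simp [hσ]
    let z := K.liftCycles (X.ιChainComplex σ) 0 (ChainComplex.next_nat_succ 0) hd
    have key : Y.ιChainComplex (f.app _ σ) ≫ L.pOpcycles 1 =
        z ≫ K.homologyπ 1 ≫ SSet.homologyMap f intCoeff.{u} 1 ≫ L.homologyι 1 := by
      rw [SSet.homologyMap, HomologicalComplex.homologyι_naturality,
        HomologicalComplex.homology_π_ι_assoc, HomologicalComplex.liftCycles_i_assoc,
        HomologicalComplex.p_opcyclesMap, ι_chainComplexMap_f_assoc]
    have h1 : L.homologyι 1 ≫ h = g := Injective.comp_factorThru _ _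
    have h2 : SSet.homologyMap f intCoeff.{u} 1 ≫ g = K.homologyι 1 ≫ φ :=
      Injective.comp_factorThru _ _
    dsimp only
    rw [reassoc_of% key, h1, h2, HomologicalComplex.homology_π_ι_assoc,
      HomologicalComplex.liftCycles_i_assoc, HomologicalComplex.p_descOpcycles,
      evalOne_ι_cochainHom]

/-- Cycles and cocycles that are dual to each other bound the rank of the homology from below. -/
lemma card_le_rank_homology {n : ℕ} {ι : Type*} [Fintype ι] [DecidableEq ι]
    (z : ι → (intCoeff.{u} ⟶ (X.chainComplex intCoeff.{u}).X n))
    (hz : ∀ i m, z i ≫ (X.chainComplex intCoeff.{u}).d n m = 0)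
    (c : ι → X _⦋n⦌ → ℝ) (hc : ∀ i, X.IsCocycle (c i))
    (hzc : ∀ i j, evalOne (z i ≫ X.cochainHom (c j)) = if i = j then 1 else 0) :
    (Fintype.card ι : Cardinal.{u}) ≤ Module.rank ℤ ((X.chainComplex intCoeff.{u}).homology n) := by
  let K := X.chainComplex intCoeff.{u}
  let v (i : ι) : intCoeff.{u} ⟶ K.homology n := K.liftCycles (z i) _ rfl (hz i _) ≫ K.homologyπ n
  let φ (j : ι) : K.homology n ⟶ realCoeff.{u} :=
    K.homologyι n ≫ K.descOpcycles (X.cochainHom (c j)) (n + 1) (ChainComplex.prev ℕ n)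
      (hc j).d_cochainHom
  have hvφ (i j : ι) : evalOne (v i ≫ φ j) = if i = j then 1 else 0 := by
    simp only [v, φ, Category.assoc, HomologicalComplex.homology_π_ι_assoc,
      HomologicalComplex.liftCycles_i_assoc, HomologicalComplex.p_descOpcycles, hzc]
  have hli : LinearIndependent ℤ fun i => (v i).hom (ULift.up 1) := by
    rw [Fintype.linearIndependent_iff]
    intro m hm j
    have h1 : evalOne (∑ i, m i • (v i ≫ φ j)) = 0 := by
      have h2 := congrArg (fun y => ((φ j).hom y).down) hm
      simp only [map_sum, map_smul, map_zero] at h2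
      simpa [evalOne] using h2
    rw [evalOne_sum_zsmul] at h1
    simp only [hvφ] at h1
    simpa using h1
  simpa using hli.cardinal_lift_le_rank

end SSet

/-! ### Cup products of cocycles of degree one -/

namespace SSet

variable {X : SSet.{u}}

/-- The edge of the simplex `σ` joining the vertices `i` and `i + 1`. -/
def spineEdge {n : ℕ} (σ : X _⦋n⦌) (i : Fin n) : X _⦋1⦌ := X.map (SimplexCategory.mkOfSucc i).op σ

/-- The cup product of `n` cochains of degree one. -/
def cupProduct {n : ℕ} (a : Fin n → X _⦋1⦌ → ℝ) (σ : X _⦋n⦌) : ℝ := ∏ i, a i (spineEdge σ i)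

lemma spineEdge_δ_of_lt {n : ℕ} (τ : X _⦋n + 1⦌) (l : Fin (n + 2)) (i : Fin n)
    (h : i.succ.castSucc < l) : spineEdge (X.δ l τ) i = spineEdge τ i.castSucc := by
  rw [spineEdge, spineEdge, ← SimplexCategory.mkOfSucc_δ_lt h, op_comp, X.map_comp]
  rfl

lemma spineEdge_δ_of_gt {n : ℕ} (τ : X _⦋n + 1⦌) (l : Fin (n + 2)) (i : Fin n)
    (h : l < i.succ.castSucc) : spineEdge (X.δ l τ) i = spineEdge τ i.succ := by
  rw [spineEdge, spineEdge, ← SimplexCategory.mkOfSucc_δ_gt h, op_comp, X.map_comp]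
  rfl

/-- Omitting an inner vertex merges its two spine edges into the long edge of a triangle, on which
the cocycle condition is additivity. -/
lemma IsCocycle.spineEdge_δ_of_eq {c : X _⦋1⦌ → ℝ} (hc : X.IsCocycle c) {n : ℕ}
    (τ : X _⦋n + 1⦌) (l : Fin (n + 2)) (i : Fin n) (h : l = i.succ.castSucc) :
    c (spineEdge (X.δ l τ) i) = c (spineEdge τ i.castSucc) + c (spineEdge τ i.succ) := by
  subst h
  -- The triangle on the vertices `i`, `i + 1`, `i + 2`.
  let θ : ⦋2⦌ ⟶ ⦋n + 1⦌ := SimplexCategory.subinterval i.val 2 (by omega)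
  have h0 : X.δ 0 (X.map θ.op τ) = spineEdge τ i.succ := by
    have : SimplexCategory.δ 0 ≫ θ = SimplexCategory.mkOfSucc i.succ := by
      rw [← SimplexCategory.mkOfSucc_one_eq_δ, SimplexCategory.mkOfSucc_subinterval_eq]
      rfl
    rw [spineEdge, ← this, op_comp, X.map_comp]
    rfl
  have h2 : X.δ 2 (X.map θ.op τ) = spineEdge τ i.castSucc := by
    have : SimplexCategory.δ 2 ≫ θ = SimplexCategory.mkOfSucc i.castSucc := by
      rw [← SimplexCategory.mkOfSucc_zero_eq_δ, SimplexCategory.mkOfSucc_subinterval_eq]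
      rfl
    rw [spineEdge, ← this, op_comp, X.map_comp]
    rfl
  have h1 : X.δ 1 (X.map θ.op τ) = spineEdge (X.δ i.succ.castSucc τ) i := by
    have : SimplexCategory.δ 1 ≫ θ =
        SimplexCategory.mkOfSucc i ≫ SimplexCategory.δ i.succ.castSucc := by
      rw [SimplexCategory.mkOfSucc_δ_eq rfl, ← SimplexCategory.diag_subinterval_eq]
      congr 1
      decide
    change _ = (X.map (SimplexCategory.δ i.succ.castSucc).op ≫
      X.map (SimplexCategory.mkOfSucc i).op) τ
    rw [← X.map_comp, ← op_comp, ← this, op_comp, X.map_comp]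
    rfl
  have := hc (X.map θ.op τ)
  rw [Fin.sum_univ_three, h0, h1, h2] at this
  simp only [Fin.val_zero, Fin.val_one, Fin.val_two, pow_zero, pow_one, even_two,
    Even.neg_one_pow] at this
  linarith

/-- The cup product of cocycles of degree one is a cocycle. -/
lemma isCocycle_cupProduct {n : ℕ} (a : Fin n → X _⦋1⦌ → ℝ) (ha : ∀ i, X.IsCocycle (a i)) :
    X.IsCocycle (cupProduct a) := by
  intro τ
  -- `P l` is the product along the spine of `τ` with edge `l` left out. The `l`-th face contributes
  -- `P (l - 1) + P l`, with one term missing at either end; `Q` shifts the index and supplies the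
  -- missing terms as zeros, so that the alternating sum telescopes.
  let P (l : ℕ) : ℝ := ∏ r : Fin n,
    if r.val < l then a r (spineEdge τ r.castSucc) else a r (spineEdge τ r.succ)
  let Q (l : ℕ) : ℝ := if l = 0 ∨ l = n + 2 then 0 else P (l - 1)
  have key (l : Fin (n + 2)) : cupProduct a (X.δ l τ) = Q l + Q (l + 1) := by
    by_cases h0 : l.val = 0
    · have hQ : Q l.val = 0 := by simp [Q, h0]
      have hQ' : Q (l.val + 1) = P 0 := by simp [Q, h0]
      rw [hQ, hQ', zero_add]
      refine Finset.prod_congr rfl fun r _ => ?_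
      rw [if_neg (Nat.not_lt_zero _), spineEdge_δ_of_gt]
      rw [Fin.lt_def, h0]
      exact Nat.succ_pos _
    by_cases h1 : l.val = n + 1
    · have hQ : Q l.val = P n := by simp [Q, h1]
      have hQ' : Q (l.val + 1) = 0 := by simp [Q, h1]
      rw [hQ, hQ', add_zero]
      refine Finset.prod_congr rfl fun r _ => ?_
      rw [if_pos r.isLt, spineEdge_δ_of_lt]
      rw [Fin.lt_def, h1]
      exact Nat.succ_lt_succ r.isLt
    obtain ⟨r, rfl⟩ : ∃ r : Fin n, l = r.succ.castSucc :=
      ⟨⟨l.val - 1, by omega⟩, by ext; simp; omega⟩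
    have hQ : Q r.succ.castSucc.val = P r.val := by
      simp [Q]
      omega
    have hQ' : Q (r.succ.castSucc.val + 1) = P (r.val + 1) := by
      simp [Q]
      omega
    rw [hQ, hQ', cupProduct, ← Finset.mul_prod_erase _ _ (Finset.mem_univ r),
      (ha r).spineEdge_δ_of_eq τ _ r rfl]
    simp only [P]
    rw [← Finset.mul_prod_erase _ _ (Finset.mem_univ r),
      ← Finset.mul_prod_erase _ (fun s : Fin n => if s.val < r.val + 1 then _ else _)
        (Finset.mem_univ r)]
    rw [if_neg (lt_irrefl _), if_pos (Nat.lt_succ_self _), add_comm (a r _), add_mul]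
    congr 2 <;> refine Finset.prod_congr rfl fun s hs => ?_
    all_goals
      have hsr : s.val ≠ r.val := fun h => (Finset.mem_erase.mp hs).1 (Fin.ext h)
      rcases lt_or_gt_of_ne hsr with h | h
      · rw [if_pos (by omega), spineEdge_δ_of_lt]
        exact Nat.succ_lt_succ h
      · rw [if_neg (by omega), spineEdge_δ_of_gt]
        exact Nat.succ_lt_succ h
  simp only [key]
  have tel (m : ℕ) : ∑ l ∈ Finset.range m, (-1 : ℝ) ^ l * (Q l + Q (l + 1)) =
      Q 0 - (-1) ^ m * Q m := by
    induction m with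
    | zero => simp
    | succ m ih => rw [Finset.sum_range_succ, ih]; ring
  rw [Fin.sum_univ_eq_sum_range (fun l => (-1 : ℝ) ^ l * (Q l + Q (l + 1))), tel]
  simp [Q]

end SSet

/-! ### Lifting to the universal cover of the circle, and winding cocycles -/

lemma Circle.exists_continuous_lift {A : Type*} [TopologicalSpace A] [ContractibleSpace A]
    (s : C(A, Circle)) : ∃ F : C(A, ℝ), ∀ a, Circle.exp (F a) = s a := by
  obtain ⟨z, ⟨H⟩⟩ := (id_nullhomotopic A).comp_right s
  obtain ⟨r, hr⟩ := Circle.exp_surjective z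
  -- The reversed homotopy starts at a constant map, which has a constant lift; the end of the
  -- lifted homotopy lifts `s`.
  let G := Circle.isCoveringMap_exp.liftHomotopy H.symm.toContinuousMap (ContinuousMap.const A r)
    (fun a => by simp [hr])
  refine ⟨G.comp ⟨fun a => (1, a), by fun_prop⟩, fun a => ?_⟩
  have := congrFun (Circle.isCoveringMap_exp.liftHomotopy_lifts H.symm.toContinuousMap
    (ContinuousMap.const A r) (fun a => by simp [hr])) (1, a)
  exact this.trans (H.symm.map_one_left a)

namespace Circle

variable {A B : Type*} [TopologicalSpace A] [ContractibleSpace A] [TopologicalSpace B]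
  [ContractibleSpace B]

/-- The number of turns that a map `s` from a contractible space to the circle makes from `a`
to `b`. -/
def turns (s : C(A, Circle)) (a b : A) : ℝ :=
  ((exists_continuous_lift s).choose b - (exists_continuous_lift s).choose a) / (2 * Real.pi)

/-- Lifts agreeing at one point coincide, so any two lifts differ by a constant, which cancels. -/
lemma turns_eq (s : C(A, Circle)) (F : C(A, ℝ)) (hF : ∀ a, Circle.exp (F a) = s a) (a b : A) :
    turns s a b = (F b - F a) / (2 * Real.pi) := by
  rw [turns]
  set G := (exists_continuous_lift s).choose
  have hG : ∀ a, Circle.exp (G a) = s a := (exists_continuous_lift s).choose_spec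
  have h : (fun x => F x + (G a - F a)) = G := by
    refine Circle.isCoveringMap_exp.eq_of_comp_eq (by fun_prop) (by fun_prop) ?_ a (by simp)
    funext x
    simp [Circle.exp_add, Circle.exp_sub, hF, hG]
  rw [← congrFun h b]
  congr 1
  ring

lemma turns_comp (s : C(A, Circle)) (g : C(B, A)) (a b : B) :
    turns (s.comp g) a b = turns s (g a) (g b) := by
  obtain ⟨F, hF⟩ := exists_continuous_lift s
  rw [turns_eq s F hF, turns_eq (s.comp g) (F.comp g) fun x => hF (g x)]
  rfl

lemma turns_add (s : C(A, Circle)) (a b c : A) : turns s a b + turns s b c = turns s a c := by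
  obtain ⟨F, hF⟩ := exists_continuous_lift s
  simp only [turns_eq s F hF]
  ring

end Circle

instance (n : ℕ) : ContractibleSpace (stdSimplex ℝ (Fin (n + 1))) :=
  (convex_stdSimplex ℝ (Fin (n + 1))).contractibleSpace
    ⟨_, (stdSimplex.vertex (S := ℝ) (0 : Fin (n + 1))).2⟩

lemma stdSimplex.sum_map_mul {ι κ : Type*} [Fintype ι] [Fintype κ] (f : ι → κ)
    (t : stdSimplex ℝ ι) (g : κ → ℝ) : ∑ p, stdSimplex.map f t p * g p = ∑ q, t q * g (f q) := by
  classical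
  rw [← Finset.sum_fiberwise Finset.univ f]
  refine Finset.sum_congr rfl fun p _ => ?_
  rw [stdSimplex.map_coe, FunOnFinite.linearMap_apply_apply, Finset.sum_mul]
  refine Finset.sum_congr rfl fun q hq => ?_
  rw [(Finset.mem_filter.mp hq).2]

namespace TopCat

variable {X : TopCat.{u}} {n m : ℕ}

/-- The singular simplex given by a continuous map on the standard simplex. -/
def singularSimplex (s : C(stdSimplex ℝ (Fin (n + 1)), X)) : (toSSet.obj X) _⦋n⦌ :=
  (toSSetObjEquiv X (op ⦋n⦌)).symm s

lemma exists_eq_singularSimplex (σ : (toSSet.obj X) _⦋n⦌) :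
    ∃ s : C(stdSimplex ℝ (Fin (n + 1)), X), σ = singularSimplex s :=
  ⟨toSSetObjEquiv X (op ⦋n⦌) σ, ((toSSetObjEquiv X (op ⦋n⦌)).symm_apply_apply σ).symm⟩

lemma toSSet_map_singularSimplex (θ : ⦋m⦌ ⟶ ⦋n⦌) (s : C(stdSimplex ℝ (Fin (n + 1)), X)) :
    (toSSet.obj X).map θ.op (singularSimplex s) =
      singularSimplex (s.comp ⟨_, stdSimplex.continuous_map θ.toOrderHom⟩) :=
  rfl

lemma δ_singularSimplex (l : Fin (n + 2)) (s : C(stdSimplex ℝ (Fin (n + 2)), X)) :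
    (toSSet.obj X).δ l (singularSimplex s) =
      singularSimplex (s.comp ⟨_, stdSimplex.continuous_map l.succAbove⟩) :=
  rfl

lemma toSSet_map_app_singularSimplex {Y : TopCat.{u}} (f : X ⟶ Y)
    (s : C(stdSimplex ℝ (Fin (n + 1)), X)) :
    (toSSet.map f).app _ (singularSimplex s) = singularSimplex (f.hom.comp s) :=
  rfl

/-- The number of turns of the composition of a path with a map to the circle. -/
def turnsCochain (f : C(X, Circle)) (σ : (toSSet.obj X) _⦋1⦌) : ℝ :=
  Circle.turns (f.comp (toSSetObjEquiv X (op ⦋1⦌) σ))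
    (stdSimplex.vertex (S := ℝ) (0 : Fin 2)) (stdSimplex.vertex (S := ℝ) (1 : Fin 2))

lemma turnsCochain_singularSimplex (f : C(X, Circle)) (s : C(stdSimplex ℝ (Fin 2), X)) :
    turnsCochain f (singularSimplex s) =
      Circle.turns (f.comp s)
        (stdSimplex.vertex (S := ℝ) (0 : Fin 2)) (stdSimplex.vertex (S := ℝ) (1 : Fin 2)) :=
  rfl

/-- A single lift over the whole triangle computes the turns along all three edges. -/
lemma isCocycle_turnsCochain (f : C(X, Circle)) : (toSSet.obj X).IsCocycle (turnsCochain f) := by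
  intro τ
  obtain ⟨s, rfl⟩ := exists_eq_singularSimplex τ
  rw [Fin.sum_univ_three]
  simp only [δ_singularSimplex, turnsCochain_singularSimplex, ← ContinuousMap.comp_assoc,
    Circle.turns_comp, ContinuousMap.coe_mk, stdSimplex.map_vertex]
  have h := Circle.turns_add (f.comp s) (stdSimplex.vertex (S := ℝ) (0 : Fin 3))
    (stdSimplex.vertex (S := ℝ) (1 : Fin 3)) (stdSimplex.vertex (S := ℝ) (2 : Fin 3))
  have e1 : (0 : Fin 3).succAbove (0 : Fin 2) = 1 := rfl
  have e2 : (0 : Fin 3).succAbove (1 : Fin 2) = 2 := rfl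
  have e3 : (1 : Fin 3).succAbove (0 : Fin 2) = 0 := rfl
  have e4 : (1 : Fin 3).succAbove (1 : Fin 2) = 2 := rfl
  have e5 : (2 : Fin 3).succAbove (0 : Fin 2) = 0 := rfl
  have e6 : (2 : Fin 3).succAbove (1 : Fin 2) = 1 := rfl
  rw [e1, e2, e3, e4, e5, e6, ← h]
  simp

end TopCat

/-! ### Affine simplices and fundamental cycles in the torus -/

namespace TorusAction

/-- The singular simplicial set of the torus. -/
abbrev singularTorus (k : ℕ) : SSet.{u} := TopCat.toSSet.obj (TopCat.of (ULift.{u} (Torus k)))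

/-- The image in the torus of the affine simplex with vertices `w`. -/
def affineMap {k n : ℕ} (w : Fin (n + 1) → Fin k → ℝ) :
    C(stdSimplex ℝ (Fin (n + 1)), ULift.{u} (Torus k)) where
  toFun t := ULift.up fun i => Circle.exp (2 * Real.pi * ∑ p, t p * w p i)
  continuous_toFun := by
    refine continuous_uliftUp.comp (continuous_pi fun i => Circle.exp.continuous.comp ?_)
    refine continuous_const.mul (continuous_finsetSum _ fun p _ => ?_)
    exact ((continuous_apply p).comp continuous_subtype_val).mul continuous_const

/-- The singular simplex of the torus with vertices `w` in its universal cover. -/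
def affineSimplex {k n : ℕ} (w : Fin (n + 1) → Fin k → ℝ) :
    (singularTorus.{u} k) _⦋n⦌ :=
  TopCat.singularSimplex (X := TopCat.of (ULift.{u} (Torus k))) (affineMap w)

lemma map_affineSimplex {k n m : ℕ} (θ : ⦋m⦌ ⟶ ⦋n⦌) (w : Fin (n + 1) → Fin k → ℝ) :
    (singularTorus.{u} k).map θ.op (affineSimplex w) =
      affineSimplex (w ∘ θ.toOrderHom) := by
  rw [affineSimplex, TopCat.toSSet_map_singularSimplex, affineSimplex]
  congr 1
  ext1 t
  apply ULift.ext
  funext i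
  simp only [affineMap, ContinuousMap.comp_apply, ContinuousMap.coe_mk, Function.comp_apply]
  congr 2
  exact stdSimplex.sum_map_mul θ.toOrderHom t fun p => w p i

lemma δ_affineSimplex {k n : ℕ} (l : Fin (n + 2)) (w : Fin (n + 2) → Fin k → ℝ) :
    (singularTorus.{u} k).δ l (affineSimplex w) =
      affineSimplex (w ∘ l.succAbove) :=
  map_affineSimplex (SimplexCategory.δ l) w

/-- Translating the vertices by an integral vector does not change the simplex in the torus. -/
lemma affineSimplex_add_intCast {k n : ℕ} (w : Fin (n + 1) → Fin k → ℝ) (v : Fin k → ℤ) :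
    affineSimplex.{u} (fun p i => w p i + v i) = affineSimplex w := by
  rw [affineSimplex, affineSimplex]
  congr 1
  ext1 t
  apply ULift.ext
  funext i
  simp only [affineMap, ContinuousMap.coe_mk]
  rw [Circle.exp_eq_exp]
  refine ⟨v i, ?_⟩
  have := stdSimplex.sum_eq_one t
  simp only [mul_add, Finset.sum_add_distrib, ← Finset.sum_mul, this]
  ring

/-- The coordinate projection of the torus. -/
def coord {k : ℕ} (i : Fin k) : C(TopCat.of (ULift.{u} (Torus k)), Circle) where
  toFun t := t.down i
  continuous_toFun := (continuous_apply i).comp continuous_uliftDown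

lemma turnsCochain_coord_affineSimplex {k : ℕ} (i : Fin k) (w : Fin 2 → Fin k → ℝ) :
    TopCat.turnsCochain (coord.{u} i) (affineSimplex w) = w 1 i - w 0 i := by
  rw [affineSimplex, TopCat.turnsCochain_singularSimplex]
  -- The affine function inside `Circle.exp` is itself a lift.
  rw [Circle.turns_eq _ ⟨fun t => 2 * Real.pi * ∑ p, t p * w p i, ?_⟩ fun t => rfl]
  · have : Real.pi ≠ 0 := Real.pi_ne_zero
    simp
    field_simp
  · refine continuous_const.mul (continuous_finsetSum _ fun p _ => ?_)
    exact ((continuous_apply p).comp continuous_subtype_val).mul continuous_const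

end TorusAction

/-- This is the cancellation in the boundary of a cube cut into simplices indexed by permutations,
with opposite facets identified; `D π l` stands for the `l`-th face. Inner faces cancel in pairs
under adjacent transpositions. Outer faces are matched by the cycle `finRotate (m + 1)` of sign
`(-1) ^ m`, against the boundary sign `(-1) ^ (m + 1)`. -/
lemma Equiv.Perm.sum_sign_smul_alternating_eq_zero {G : Type*} [AddCommGroup G] {m : ℕ}
    (D : Equiv.Perm (Fin (m + 1)) → Fin (m + 2) → G)
    (hswap : ∀ (π : Equiv.Perm (Fin (m + 1))) (r : Fin m),
      D (π * Equiv.swap r.castSucc r.succ) r.castSucc.succ = D π r.castSucc.succ)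
    (hrotate : ∀ π : Equiv.Perm (Fin (m + 1)), D (π * finRotate (m + 1)) (Fin.last _) = D π 0) :
    ∑ π : Equiv.Perm (Fin (m + 1)), (sign π : ℤ) • ∑ l : Fin (m + 2), (-1 : ℤ) ^ l.val • D π l
      = 0 := by
  have h1 (r : Fin m) : ∑ π : Equiv.Perm (Fin (m + 1)), (sign π : ℤ) • D π r.castSucc.succ = 0 := by
    refine Finset.sum_involution (fun π _ => π * Equiv.swap r.castSucc r.succ) ?_ ?_ ?_ ?_
    · intro π _
      rw [hswap]
      simp [Equiv.Perm.sign_swap (Fin.castSucc_lt_succ (i := r)).ne]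
    · intro π _ _ h
      have := Equiv.swap_eq_one_iff.mp (mul_eq_left.mp h)
      exact (Fin.castSucc_lt_succ (i := r)).ne this
    · intro π _
      simp
    · intro π _
      simp [mul_assoc]
  have h2 : ∑ π : Equiv.Perm (Fin (m + 1)), (sign π : ℤ) • D π (Fin.last _) =
      (-1 : ℤ) ^ m • ∑ π : Equiv.Perm (Fin (m + 1)), (sign π : ℤ) • D π 0 := by
    rw [← Equiv.sum_comp (Equiv.mulRight (finRotate (m + 1))), Finset.smul_sum]
    refine Finset.sum_congr rfl fun π _ => ?_
    rw [Equiv.coe_mulRight, hrotate, Equiv.Perm.sign_mul, sign_finRotate, smul_smul]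
    simp [mul_comm]
  simp only [Finset.smul_sum, smul_smul]
  rw [Finset.sum_comm]
  have h3 (l : Fin (m + 2)) : ∑ π : Equiv.Perm (Fin (m + 1)), ((sign π : ℤ) * (-1) ^ l.val) • D π l
      = (-1 : ℤ) ^ l.val • ∑ π : Equiv.Perm (Fin (m + 1)), (sign π : ℤ) • D π l := by
    simp only [Finset.smul_sum, smul_smul, mul_comm]
  simp only [h3]
  rw [Fin.sum_univ_succ, Fin.sum_univ_castSucc]
  simp only [h1, smul_zero, Finset.sum_const_zero, zero_add, Fin.succ_last, h2, smul_smul]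
  rw [← add_smul]
  simp [pow_succ, ← mul_pow]

namespace TorusAction

/-- The vertices of the lattice path with the steps `g`. -/
def pathVertex {k n : ℕ} (g : Fin n → Fin k → ℤ) (p : Fin (n + 1)) : Fin k → ℤ :=
  ∑ q with q.castSucc < p, g q

@[simp]
lemma pathVertex_zero {k n : ℕ} (g : Fin n → Fin k → ℤ) : pathVertex g 0 = 0 := by
  simp [pathVertex]

lemma pathVertex_castSucc {k n : ℕ} (g : Fin (n + 1) → Fin k → ℤ) (p : Fin (n + 1)) :
    pathVertex g p.castSucc = pathVertex (g ∘ Fin.castSucc) p := by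
  rw [pathVertex, pathVertex, Finset.sum_filter, Finset.sum_filter, Fin.sum_univ_castSucc]
  simp [not_lt.mpr (Fin.le_last p)]

lemma pathVertex_succ {k n : ℕ} (g : Fin (n + 1) → Fin k → ℤ) (p : Fin (n + 1)) :
    pathVertex g p.succ = pathVertex (g ∘ Fin.succ) p + g 0 := by
  rw [pathVertex, pathVertex, Finset.sum_filter, Finset.sum_filter, Fin.sum_univ_succ, add_comm]
  simp

lemma pathVertex_succ_eq_add {k n : ℕ} (g : Fin n → Fin k → ℤ) (r : Fin n) :
    pathVertex g r.succ = g r + pathVertex g r.castSucc := by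
  rw [pathVertex, pathVertex, ← Finset.sum_insert (s := Finset.univ.filter _) (by simp)]
  refine Finset.sum_congr ?_ fun _ _ => rfl
  ext q
  simp [le_iff_eq_or_lt]

@[simp]
lemma pathVertex_one {k : ℕ} (g : Fin 1 → Fin k → ℤ) : pathVertex g 1 = g 0 := by
  simpa using pathVertex_succ_eq_add g 0

lemma pathVertex_comp_perm {k n : ℕ} (g : Fin n → Fin k → ℤ) (p : Fin (n + 1))
    (π : Equiv.Perm (Fin n)) (hπ : ∀ q, (π q).castSucc < p ↔ q.castSucc < p) :
    pathVertex (g ∘ π) p = pathVertex g p := by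
  rw [pathVertex, pathVertex, Finset.sum_filter, Finset.sum_filter,
    ← Equiv.sum_comp π fun q => if q.castSucc < p then g q else 0]
  simp [hπ]

/-- The simplex of the torus that is the image of the simplex spanned by a lattice path. -/
def pathSimplex {k n : ℕ} (g : Fin n → Fin k → ℤ) :
    (singularTorus.{u} k) _⦋n⦌ :=
  affineSimplex fun p i => pathVertex g p i

lemma pathSimplex_face_last {k n : ℕ} (g : Fin (n + 1) → Fin k → ℤ) :
    (singularTorus.{u} k).δ (Fin.last _) (pathSimplex g) =
      pathSimplex (g ∘ Fin.castSucc) := by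
  rw [pathSimplex, δ_affineSimplex, pathSimplex]
  congr 1
  funext p i
  simp [pathVertex_castSucc]

/-- This face starts at the lattice point `g 0` instead of the origin, a translation that is
invisible in the torus. -/
lemma pathSimplex_face_zero {k n : ℕ} (g : Fin (n + 1) → Fin k → ℤ) :
    (singularTorus.{u} k).δ 0 (pathSimplex g) =
      pathSimplex (g ∘ Fin.succ) := by
  rw [pathSimplex, δ_affineSimplex, pathSimplex]
  refine Eq.trans ?_ (affineSimplex_add_intCast _ (g 0))
  congr 1
  funext p i
  simp [pathVertex_succ]

/-- The order of steps `r` and `r + 1` affects only the vertex `r + 1` between them, which this face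
omits. -/
lemma pathSimplex_face_swap {k n : ℕ} (g : Fin (n + 1) → Fin k → ℤ) (r : Fin n) :
    (singularTorus.{u} k).δ r.castSucc.succ
        (pathSimplex (g ∘ Equiv.swap r.castSucc r.succ)) =
      (singularTorus.{u} k).δ r.castSucc.succ (pathSimplex g) := by
  rw [pathSimplex, δ_affineSimplex, pathSimplex, δ_affineSimplex]
  congr 1
  funext p i
  simp only [Function.comp_apply]
  rw [pathVertex_comp_perm]
  intro q
  have hne := Fin.succAbove_ne r.castSucc.succ p
  generalize r.castSucc.succ.succAbove p = p' at hne
  rw [Equiv.swap_apply_def]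
  simp only [Fin.lt_def, Fin.ext_iff, ne_eq] at hne ⊢
  split_ifs <;> simp_all <;> omega

/-- The fundamental cycle of the torus mapped to `T^k` by the homomorphism with the columns `g`. -/
def torusCycle {k n : ℕ} (g : Fin n → Fin k → ℤ) : SSet.intCoeff.{u} ⟶
    ((singularTorus.{u} k).chainComplex SSet.intCoeff.{u}).X n :=
  ∑ π : Equiv.Perm (Fin n), (Equiv.Perm.sign π : ℤ) •
    (singularTorus.{u} k).ιChainComplex (pathSimplex (g ∘ π))

lemma torusCycle_d {k n : ℕ} (g : Fin n → Fin k → ℤ) (m : ℕ) :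
    torusCycle.{u} g ≫ ((singularTorus.{u} k).chainComplex SSet.intCoeff.{u}).d n m = 0 := by
  by_cases hnm : (ComplexShape.down ℕ).Rel n m
  swap
  · rw [HomologicalComplex.shape _ _ _ hnm, comp_zero]
  obtain rfl : m + 1 = n := hnm
  rw [torusCycle, Preadditive.sum_comp]
  simp only [Preadditive.zsmul_comp, SSet.ιChainComplex_d]
  refine Equiv.Perm.sum_sign_smul_alternating_eq_zero
    (fun π l => (singularTorus.{u} k).ιChainComplex
      ((singularTorus.{u} k).δ l (pathSimplex (g ∘ π)))) ?_ ?_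
  · intro π r
    simp only [Equiv.Perm.coe_mul, ← Function.comp_assoc]
    rw [pathSimplex_face_swap]
  · intro π
    dsimp only
    rw [pathSimplex_face_last, pathSimplex_face_zero]
    congr 2
    funext q
    simp

/-- The spine of the simplex of a lattice path consists of loops. -/
lemma spineEdge_pathSimplex {k n : ℕ} (g : Fin n → Fin k → ℤ) (r : Fin n) :
    SSet.spineEdge (pathSimplex.{u} g) r = pathSimplex fun _ : Fin 1 => g r := by
  rw [SSet.spineEdge, pathSimplex, map_affineSimplex, pathSimplex]
  refine Eq.trans ?_ (affineSimplex_add_intCast _ (pathVertex g r.castSucc))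
  congr 1
  funext p i
  fin_cases p
  · simp
  · simp [pathVertex_succ_eq_add]

lemma pathSimplex_one_face {k : ℕ} (g : Fin 1 → Fin k → ℤ) :
    (singularTorus.{u} k).δ 0 (pathSimplex g) =
      (singularTorus.{u} k).δ 1 (pathSimplex g) := by
  rw [pathSimplex_face_zero]
  exact (pathSimplex_face_last g).symm ▸ congrArg _ (Subsingleton.elim _ _)

lemma turnsCochain_pathSimplex {k : ℕ} (g : Fin 1 → Fin k → ℤ) (i : Fin k) :
    TopCat.turnsCochain (coord.{u} i) (pathSimplex g) = g 0 i := by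
  rw [pathSimplex, turnsCochain_coord_affineSimplex]
  simp

end TorusAction

/-- The entries are the winding numbers of the circles in `s` along the coordinates in `t`. If `s ≠
t`, an element of `t` outside `s` gives a zero column. -/
lemma Finset.det_orderEmbOfFin {k n : ℕ} {s t : Finset (Fin k)} (hs : s.card = n)
    (ht : t.card = n) :
    (Matrix.of fun a b : Fin n =>
      if t.orderEmbOfFin ht b = s.orderEmbOfFin hs a then (1 : ℝ) else 0).det =
      if s = t then 1 else 0 := by
  split_ifs with h
  · subst h
    convert Matrix.det_one (n := Fin n) (R := ℝ) using 2
    ext a b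
    simp [Matrix.one_apply, eq_comm]
  · obtain ⟨x, hxt, hxs⟩ : ∃ x ∈ t, x ∉ s := by
      by_contra! hts
      exact h (Finset.eq_of_subset_of_card_le hts (by omega)).symm
    obtain ⟨b, rfl⟩ : x ∈ Set.range (t.orderEmbOfFin ht) := by simpa using hxt
    refine Matrix.det_eq_zero_of_column_eq_zero b fun a => ?_
    rw [Matrix.of_apply, if_neg]
    rintro hab
    exact hxs (hab ▸ s.orderEmbOfFin_mem hs a)

/-! ### The binomial lower bound for Betti numbers -/

namespace TorusAction

/-- The winding numbers of the torus extend along a map that is injective on `H_1`. -/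
lemma exists_isCocycle_winding {k : ℕ} {X : TopCat.{u}} (f : TopCat.of (ULift.{u} (Torus k)) ⟶ X)
    (hf : Function.Injective ((integralHomology.{u} 1).map f)) (i : Fin k) :
    ∃ c : (TopCat.toSSet.obj X) _⦋1⦌ → ℝ, (TopCat.toSSet.obj X).IsCocycle c ∧
      ∀ g : Fin 1 → Fin k → ℤ, c ((TopCat.toSSet.map f).app _ (pathSimplex g)) = g 0 i := by
  have : Mono (SSet.homologyMap (TopCat.toSSet.map f) SSet.intCoeff.{u} 1) :=
    (ModuleCat.mono_iff_injective ((integralHomology.{u} 1).map f)).mpr hf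
  obtain ⟨c, hc, h⟩ := SSet.exists_isCocycle_extension (TopCat.toSSet.map f)
    (TopCat.isCocycle_turnsCochain (coord.{u} i))
  refine ⟨c, hc, fun g => ?_⟩
  rw [h _ (pathSimplex_one_face g), turnsCochain_pathSimplex]

/-- A map from the torus that is injective on `H_1` bounds the Betti numbers from below. -/
theorem choose_le_bettiNumber {k : ℕ} {M : Type u} [TopologicalSpace M]
    (f : C(ULift.{u} (Torus k), M))
    (hf : Function.Injective ((integralHomology.{u} 1).map (TopCat.ofHom f))) (j : ℕ) :
    (Nat.choose k j : Cardinal.{u}) ≤ bettiNumber M j := by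
  choose c hc hcf using exists_isCocycle_winding (TopCat.ofHom f) hf
  let F := TopCat.toSSet.map (TopCat.ofHom f)
  have hcard : Fintype.card (Finset.powersetCard j (Finset.univ : Finset (Fin k))) =
      Nat.choose k j := by
    rw [Fintype.card_coe, Finset.card_powersetCard, Finset.card_univ, Fintype.card_fin]
  have hs (s : Finset.powersetCard j (Finset.univ : Finset (Fin k))) : s.1.card = j :=
    (Finset.mem_powersetCard.mp s.2).2
  rw [← hcard]
  refine SSet.card_le_rank_homology (X := TopCat.toSSet.obj (TopCat.of M))
    (fun s => torusCycle.{u} (fun q => Pi.single (s.1.orderEmbOfFin (hs s) q) 1) ≫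
      (SSet.chainComplexMap F SSet.intCoeff.{u}).f j) (fun s m => ?_)
    (fun t => SSet.cupProduct fun q => c (t.1.orderEmbOfFin (hs t) q))
    (fun t => SSet.isCocycle_cupProduct _ fun q => hc _) fun s t => ?_
  · rw [Category.assoc, HomologicalComplex.Hom.comm, reassoc_of% torusCycle_d, zero_comp]
  · rw [torusCycle, Preadditive.sum_comp, Preadditive.sum_comp]
    simp only [Preadditive.zsmul_comp, SSet.ι_chainComplexMap_f]
    rw [SSet.evalOne_sum_zsmul]
    simp only [SSet.evalOne_ι_cochainHom, SSet.cupProduct]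
    -- The spine edges are images of loops, where the values of `c` are known.
    have hedge (g : Fin j → Fin k → ℤ) (q : Fin j) :
        SSet.spineEdge (F.app _ (pathSimplex g)) q = F.app _ (pathSimplex fun _ : Fin 1 => g q) := by
      rw [← spineEdge_pathSimplex]
      exact (NatTrans.naturality_apply F _ _).symm
    simp only [hedge, F, hcf]
    -- The signed sum over permutations is the Leibniz expansion of this determinant.
    have := Finset.det_orderEmbOfFin (hs s) (hs t)
    simp only [← Subtype.ext_iff, Matrix.det_apply'] at this
    rw [← this]
    simp [Pi.single_apply]

end TorusAction

/-! ### Homotopy invariance of cocycles of degree one -/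

lemma stdSimplex.map_succAbove_apply {n : ℕ} (l : Fin (n + 2)) (t : stdSimplex ℝ (Fin (n + 1)))
    (q : Fin (n + 1)) : stdSimplex.map l.succAbove t (l.succAbove q) = t q := by
  rw [stdSimplex.map_coe, FunOnFinite.linearMap_apply_apply, Finset.sum_filter]
  simp

lemma stdSimplex.map_succAbove_self {n : ℕ} (l : Fin (n + 2)) (t : stdSimplex ℝ (Fin (n + 1))) :
    stdSimplex.map l.succAbove t l = 0 := by
  rw [stdSimplex.map_coe, FunOnFinite.linearMap_apply_apply, Finset.sum_filter]
  simp [Fin.succAbove_ne]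

/-- A coordinate of the standard simplex, as a map to the unit interval. -/
def stdSimplex.coordinate {n : ℕ} (p : Fin n) : C(stdSimplex ℝ (Fin n), unitInterval) where
  toFun t := ⟨t p, stdSimplex.zero_le t p, stdSimplex.le_one t p⟩
  continuous_toFun := ((continuous_apply p).comp continuous_subtype_val).subtype_mk _

/-- One minus a coordinate of the standard simplex, as a map to the unit interval. -/
def stdSimplex.coordinateSymm {n : ℕ} (p : Fin n) : C(stdSimplex ℝ (Fin n), unitInterval) where
  toFun t := unitInterval.symm (stdSimplex.coordinate p t)
  continuous_toFun := by fun_prop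

namespace TopCat

variable {X : TopCat.{u}}

/-- The singular simplex given by a path. -/
def simplexOfPath {x y : X} (γ : Path x y) : (toSSet.obj X) _⦋1⦌ :=
  singularSimplex (γ.toContinuousMap.comp (stdSimplex.coordinate 1))

/-- All faces of the constant triangle are this edge, and the signs of three faces add up to one. -/
lemma cocycle_simplexOfPath_refl {c : (toSSet.obj X) _⦋1⦌ → ℝ}
    (hc : (toSSet.obj X).IsCocycle c) (x : X) : c (simplexOfPath (Path.refl x)) = 0 := by
  have := hc (singularSimplex (ContinuousMap.const _ x))
  rw [Fin.sum_univ_three] at this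
  simp only [δ_singularSimplex, ContinuousMap.const_comp] at this
  have h : simplexOfPath (Path.refl x) = singularSimplex (ContinuousMap.const _ x) := rfl
  rw [h]
  simpa using this

/-- A cocycle of degree one takes the same values on homotopic paths. -/
lemma cocycle_simplexOfPath_eq_of_homotopic {c : (toSSet.obj X) _⦋1⦌ → ℝ}
    (hc : (toSSet.obj X).IsCocycle c) {x y : X} {γ γ' : Path x y} (h : γ.Homotopic γ') :
    c (simplexOfPath γ) = c (simplexOfPath γ') := by
  obtain ⟨F⟩ := h
  -- `A` and `B` are the halves of the homotopy square on either side of the diagonal, which is face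
  -- 1 of both. `A` has the sides `γ` and constant `y`; `B` has constant `x` and `γ'`.
  let A : C(stdSimplex ℝ (Fin 3), X) :=
    F.toContinuousMap.comp ((stdSimplex.coordinate 2).prodMk (stdSimplex.coordinateSymm 0))
  let B : C(stdSimplex ℝ (Fin 3), X) :=
    F.toContinuousMap.comp ((stdSimplex.coordinateSymm 0).prodMk (stdSimplex.coordinate 2))
  have hA := hc (singularSimplex A)
  have hB := hc (singularSimplex B)
  have r0 (l : Fin 3) (t : stdSimplex ℝ (Fin 2)) := stdSimplex.map_succAbove_apply l t 0
  have r1 (l : Fin 3) (t : stdSimplex ℝ (Fin 2)) := stdSimplex.map_succAbove_apply l t 1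
  have rs (l : Fin 3) (t : stdSimplex ℝ (Fin 2)) := stdSimplex.map_succAbove_self l t
  have hsum (t : stdSimplex ℝ (Fin 2)) : 1 - t 0 = t 1 := by
    rw [← stdSimplex.add_eq_one t]; ring
  have c00 (t : stdSimplex ℝ (Fin 2)) :
      stdSimplex.coordinateSymm 0 (stdSimplex.map (Fin.succAbove (0 : Fin 3)) t) = 1 :=
    Subtype.ext ((congrArg (1 - ·) (rs 0 t)).trans (sub_zero 1))
  have c02 (t : stdSimplex ℝ (Fin 2)) :
      stdSimplex.coordinate 2 (stdSimplex.map (Fin.succAbove (0 : Fin 3)) t) =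
        stdSimplex.coordinate 1 t :=
    Subtype.ext (r1 0 t)
  have c10 (t : stdSimplex ℝ (Fin 2)) :
      stdSimplex.coordinateSymm 0 (stdSimplex.map (Fin.succAbove (1 : Fin 3)) t) =
        stdSimplex.coordinate 1 t :=
    Subtype.ext ((congrArg (1 - ·) (r0 1 t)).trans (hsum t))
  have c12 (t : stdSimplex ℝ (Fin 2)) :
      stdSimplex.coordinate 2 (stdSimplex.map (Fin.succAbove (1 : Fin 3)) t) =
        stdSimplex.coordinate 1 t :=
    Subtype.ext (r1 1 t)
  have c20 (t : stdSimplex ℝ (Fin 2)) :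
      stdSimplex.coordinateSymm 0 (stdSimplex.map (Fin.succAbove (2 : Fin 3)) t) =
        stdSimplex.coordinate 1 t :=
    Subtype.ext ((congrArg (1 - ·) (r0 2 t)).trans (hsum t))
  have c22 (t : stdSimplex ℝ (Fin 2)) :
      stdSimplex.coordinate 2 (stdSimplex.map (Fin.succAbove (2 : Fin 3)) t) = 0 :=
    Subtype.ext (rs 2 t)
  have a0 : (toSSet.obj X).δ 0 (singularSimplex A) = simplexOfPath (Path.refl y) := by
    rw [δ_singularSimplex, simplexOfPath]
    congr 1
    ext t
    simp [A, c00, c02, -Fin.succAbove_zero]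
  have a2 : (toSSet.obj X).δ 2 (singularSimplex A) = simplexOfPath γ := by
    rw [δ_singularSimplex, simplexOfPath]
    congr 1
    ext t
    simp [A, c20, c22]
  have b0 : (toSSet.obj X).δ 0 (singularSimplex B) = simplexOfPath γ' := by
    rw [δ_singularSimplex, simplexOfPath]
    congr 1
    ext t
    simp [B, c00, c02, -Fin.succAbove_zero]
  have b2 : (toSSet.obj X).δ 2 (singularSimplex B) = simplexOfPath (Path.refl x) := by
    rw [δ_singularSimplex, simplexOfPath]
    congr 1
    ext t
    simp [B, c20, c22]
  have ab : (toSSet.obj X).δ 1 (singularSimplex A) = (toSSet.obj X).δ 1 (singularSimplex B) := by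
    rw [δ_singularSimplex, δ_singularSimplex]
    congr 1
    ext t
    simp [A, B, c10, c12]
  rw [Fin.sum_univ_three, a0, a2, cocycle_simplexOfPath_refl hc] at hA
  rw [Fin.sum_univ_three, b0, b2, cocycle_simplexOfPath_refl hc, ← ab] at hB
  simp only [Fin.val_zero, Fin.val_one, Fin.val_two, pow_zero, pow_one, even_two,
    Even.neg_one_pow] at hA hB
  linarith

end TopCat

/-! ### The dimension of the torus is at most that of the manifold -/

/-- Simultaneous approximation of a multiple of a real vector by an integral vector. -/
lemma exists_int_vector_near_multiple {k : ℕ} {v : Fin k → ℝ} (hv : v ≠ 0) {ε : ℝ} (hε : 0 < ε) :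
    ∃ (t : ℝ) (m : Fin k → ℤ), m ≠ 0 ∧ ∀ i, |m i - t * v i| < ε := by
  obtain ⟨i₀, hi₀⟩ := Function.ne_iff.mp hv
  rw [Pi.zero_apply] at hi₀
  -- By compactness two of these points are close together; the difference of their integral parts
  -- is `m`. Its coordinate `i₀` is the difference of the two indices, hence nonzero.
  let u (N : ℕ) : Fin k → ℝ := fun i => Int.fract (N * (v i / v i₀))
  obtain ⟨a, -, φ, hφ, hlim⟩ := (isCompact_Icc (a := (0 : Fin k → ℝ)) (b := 1)).tendsto_subseq
    (x := u) fun N => ⟨fun i => Int.fract_nonneg _, fun i => (Int.fract_lt_one _).le⟩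
  obtain ⟨N, hN⟩ := Metric.cauchySeq_iff.mp hlim.cauchySeq ε hε
  have hd := hN (N + 1) (by omega) N le_rfl
  have hlt : φ N < φ (N + 1) := hφ (Nat.lt_succ_self N)
  refine ⟨((φ (N + 1) : ℝ) - φ N) / v i₀,
    fun i => ⌊(φ (N + 1) : ℝ) * (v i / v i₀)⌋ - ⌊(φ N : ℝ) * (v i / v i₀)⌋, ?_, fun i => ?_⟩
  · refine Function.ne_iff.mpr ⟨i₀, ?_⟩
    simp only [div_self hi₀, mul_one, Int.floor_natCast, Pi.zero_apply]
    omega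
  · have hi := (dist_pi_lt_iff hε).mp hd i
    rw [Real.dist_eq, abs_sub_comm] at hi
    convert hi using 2
    simp only [u, Function.comp_apply, Int.fract]
    push_cast
    ring

section

variable {𝕜 : Type*} [NontriviallyNormedField 𝕜] {E : Type*} [NormedAddCommGroup E]
  [NormedSpace 𝕜 E] {H : Type*} [TopologicalSpace H] {I : ModelWithCorners 𝕜 E H} {N : Type*}
  [TopologicalSpace N] [ChartedSpace H N] {ι : Type*} [Fintype ι] {E' : ι → Type*}
  [∀ i, NormedAddCommGroup (E' i)] [∀ i, NormedSpace 𝕜 (E' i)] {H' : ι → Type*}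
  [∀ i, TopologicalSpace (H' i)] {J : ∀ i, ModelWithCorners 𝕜 (E' i) (H' i)} {P : ι → Type*}
  [∀ i, TopologicalSpace (P i)] [∀ i, ChartedSpace (H' i) (P i)] {r : ℕ∞ω}

/-- A map to a finite product of manifolds is smooth if its components are. -/
lemma ContMDiff.pi_manifold {f : N → ∀ i, P i} (hf : ∀ i, ContMDiff I (J i) r fun x => f x i) :
    ContMDiff I (ModelWithCorners.pi J) r f := by
  intro x
  rw [contMDiffAt_iff]
  refine ⟨continuousAt_pi.mpr fun i => (hf i).continuous.continuousAt, ?_⟩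
  rw [contDiffWithinAt_pi]
  intro i
  exact (contMDiffAt_iff.mp (hf i x)).2

end

namespace TorusAction

/-- The exponential map of the torus. -/
def torusExp {k : ℕ} (v : Fin k → ℝ) : Torus k := fun i => Circle.exp (v i)

lemma torusExp_add {k : ℕ} (v w : Fin k → ℝ) : torusExp (v + w) = torusExp v * torusExp w := by
  funext i
  simp [torusExp, Circle.exp_add]

@[simp]
lemma torusExp_zero {k : ℕ} : torusExp (0 : Fin k → ℝ) = 1 := by
  funext i
  simp [torusExp]

lemma contMDiff_torusExp {k : ℕ} :
    ContMDiff 𝓘(ℝ, Fin k → ℝ) (torusModel k) ∞ (torusExp (k := k)) := by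
  refine ContMDiff.pi_manifold fun i => contMDiff_circleExp.comp ?_
  exact (ContinuousLinearMap.proj (R := ℝ) (φ := fun _ : Fin k => ℝ) i).contMDiff

lemma continuous_torusExp {k : ℕ} : Continuous (torusExp (k := k)) :=
  contMDiff_torusExp.continuous

section

variable {k n : ℕ} {M : Type u} [TopologicalSpace M] [T2Space M]
    [ChartedSpace (EuclideanSpace ℝ (Fin n)) M] [IsManifold (𝓡 n) ∞ M]
    [MulAction (Torus k) M] [ContinuousSMul (Torus k) M]
    [ContMDiffSMul (torusModel k) (𝓡 n) ∞ (Torus k) M]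

/-- If the torus has larger dimension than the manifold, every point is fixed by a nontrivial
one-parameter subgroup. -/
lemma exists_oneParameter_fixing (h : n < k) (x : M) :
    ∃ v : Fin k → ℝ, v ≠ 0 ∧ ∀ s : ℝ, torusExp (s • v) • x = x := by
  let ev (v : Fin k → ℝ) : M := torusExp v • x
  have hev : ContMDiff 𝓘(ℝ, Fin k → ℝ) (𝓡 n) ∞ ev :=
    (ContMDiffSMul.contMDiff_smul (I := torusModel k) (I' := 𝓡 n) (n := ∞)
      (G := Torus k) (M := M)).comp
      (contMDiff_torusExp.prodMk contMDiff_const)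
  let D : (Fin k → ℝ) →L[ℝ] EuclideanSpace ℝ (Fin n) := mfderiv 𝓘(ℝ, Fin k → ℝ) (𝓡 n) ev 0
  have hD : HasMFDerivAt 𝓘(ℝ, Fin k → ℝ) (𝓡 n) ev 0 D :=
    (hev.mdifferentiable (by simp) 0).hasMFDerivAt
  obtain ⟨v, hv, hv0⟩ : ∃ v ∈ LinearMap.ker D.toLinearMap, v ≠ 0 :=
    Submodule.exists_mem_ne_zero_of_ne_bot
      (LinearMap.ker_ne_bot_of_finrank_lt (by simpa using h))
  refine ⟨v, hv0, ?_⟩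
  let c (s : ℝ) : M := torusExp (s • v) • x
  have hc0 : c 0 = x := by simp [c]
  have hcadd (s h : ℝ) : c (s + h) = torusExp (s • v) • c h := by
    simp only [c, add_smul, torusExp_add, mul_smul]
  have hcc : Continuous c := by
    have := continuous_torusExp (k := k)
    fun_prop
  -- Near `s` the curve is the translate by `torusExp (s • v)` of the curve near `0`, where the
  -- derivative is `D v = 0`.
  have hderiv (s : ℝ) : HasMFDerivAt 𝓘(ℝ, ℝ) (𝓡 n) c s
      (0 : ℝ →L[ℝ] EuclideanSpace ℝ (Fin n)) := by
    have h1 : HasMFDerivAt 𝓘(ℝ, ℝ) 𝓘(ℝ, Fin k → ℝ) (fun r : ℝ => (r - s) • v) s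
        (ContinuousLinearMap.toSpanSingleton ℝ v) := by
      refine HasFDerivAt.hasMFDerivAt ?_
      have := (((hasDerivAt_id s).sub_const s).smul_const v).hasFDerivAt
      rwa [one_smul] at this
    have h2 : HasMFDerivAt 𝓘(ℝ, Fin k → ℝ) (𝓡 n) ev ((s - s) • v) D := by
      rw [sub_self, zero_smul]
      exact hD
    have hlin : D.comp (ContinuousLinearMap.toSpanSingleton ℝ v) = 0 := by
      ext1
      simpa using hv
    have h3 : HasMFDerivAt 𝓘(ℝ, ℝ) (𝓡 n) (ev ∘ fun r : ℝ => (r - s) • v) s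
        (0 : ℝ →L[ℝ] EuclideanSpace ℝ (Fin n)) := by
      rw [← hlin]
      exact h2.comp s h1
    have h4 : ContMDiff (𝓡 n) (𝓡 n) ∞ fun y : M => torusExp (s • v) • y :=
      (ContMDiffSMul.contMDiff_smul (I := torusModel k) (I' := 𝓡 n) (n := ∞)
        (G := Torus k) (M := M)).comp (contMDiff_const.prodMk contMDiff_id)
    let L : EuclideanSpace ℝ (Fin n) →L[ℝ] EuclideanSpace ℝ (Fin n) :=
      mfderiv (𝓡 n) (𝓡 n) (fun y : M => torusExp (s • v) • y) (ev ((s - s) • v))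
    have h5 := (h4.mdifferentiable (by simp) (ev ((s - s) • v))).hasMFDerivAt.comp s h3
    have hfun : ((fun y : M => torusExp (s • v) • y) ∘ ev ∘ fun r : ℝ => (r - s) • v) = c := by
      funext r
      have := hcadd s (r - s)
      rw [add_sub_cancel] at this
      exact this.symm
    rw [hfun] at h5
    rw [← (L.comp_zero : L.comp (0 : ℝ →L[ℝ] EuclideanSpace ℝ (Fin n)) = 0)]
    exact h5
  have hloc : ∀ᶠ s in nhds (0 : ℝ), c s = x := by
    have hU : c ⁻¹' (chartAt (EuclideanSpace ℝ (Fin n)) x).source ∈ nhds (0 : ℝ) := by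
      refine hcc.continuousAt.preimage_mem_nhds ?_
      rw [hc0]
      exact chart_source_mem_nhds _ x
    obtain ⟨ε, hε, hball⟩ := Metric.mem_nhds_iff.mp hU
    have hψ (s : ℝ) (hs : s ∈ Metric.ball (0 : ℝ) ε) :
        HasFDerivAt (extChartAt (𝓡 n) x ∘ c) (0 : ℝ →L[ℝ] EuclideanSpace ℝ (Fin n)) s := by
      let L : EuclideanSpace ℝ (Fin n) →L[ℝ] EuclideanSpace ℝ (Fin n) :=
        mfderiv (𝓡 n) 𝓘(ℝ, EuclideanSpace ℝ (Fin n)) (extChartAt (𝓡 n) x) (c s)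
      rw [← (L.comp_zero : L.comp (0 : ℝ →L[ℝ] EuclideanSpace ℝ (Fin n)) = 0)]
      exact ((mdifferentiableAt_extChartAt (I := 𝓡 n) (hball hs)).hasMFDerivAt.comp s
        (hderiv s)).hasFDerivAt
    filter_upwards [Metric.ball_mem_nhds (0 : ℝ) hε] with s hs
    have heq : (extChartAt (𝓡 n) x ∘ c) s = (extChartAt (𝓡 n) x ∘ c) 0 :=
      Metric.isOpen_ball.is_const_of_fderiv_eq_zero (convex_ball (0 : ℝ) ε).isPreconnected
        (fun r hr => (hψ r hr).differentiableAt.differentiableWithinAt)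
        (fun r hr => (hψ r hr).fderiv) hs (Metric.mem_ball_self hε)
    have hinj := (extChartAt (𝓡 n) x).injOn
    rw [extChartAt_source] at hinj
    rw [← hc0]
    exact hinj (hball hs) (hball (Metric.mem_ball_self hε)) heq
  -- Homogeneity carries constancy near `0` to every `s` in this set, and `ℝ` is connected.
  have hclopen : IsClopen {s | c s = x} := by
    refine ⟨isClosed_eq hcc continuous_const, ?_⟩
    rw [isOpen_iff_mem_nhds]
    intro s hs
    have : Filter.Tendsto (fun r => r - s) (nhds s) (nhds 0) := by
      have : Continuous fun r : ℝ => r - s := by fun_prop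
      simpa using this.tendsto s
    filter_upwards [this.eventually hloc] with r hr
    have h2 := hcadd s (r - s)
    rw [hr] at h2
    rw [← show s + (r - s) = r by ring, h2]
    exact hs
  have := hclopen.eq_univ ⟨0, hc0⟩
  exact fun s => Set.eq_univ_iff_forall.mp this s

/-- A torus that acts homologically injectively has at most the dimension of the manifold. -/
lemma HomologicallyInjectiveAt.le_dim {x : M} (hx : HomologicallyInjectiveAt k x) : k ≤ n := by
  by_contra! hnk
  obtain ⟨v, hv0, hv⟩ := exists_oneParameter_fixing (n := n) hnk x
  let φ := chartAt (EuclideanSpace ℝ (Fin n)) x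
  obtain ⟨r, hr, hrφ⟩ := Metric.isOpen_iff.mp φ.open_target (φ x)
    (φ.map_source (mem_chart_source _ x))
  have hball : φ.source ∩ φ ⁻¹' Metric.ball (φ x) r ∈ nhds (torusExp (0 : Fin k → ℝ) • x) := by
    rw [torusExp_zero, one_smul]
    exact (φ.isOpen_inter_preimage Metric.isOpen_ball).mem_nhds
      ⟨mem_chart_source _ x, Metric.mem_ball_self hr⟩
  have hcont : Continuous fun w : Fin k → ℝ => torusExp w • x := by
    have := continuous_torusExp (k := k)
    fun_prop
  obtain ⟨δ, hδ, hδφ⟩ := Metric.mem_nhds_iff.mp (hcont.continuousAt.preimage_mem_nhds hball)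
  obtain ⟨t, m, hm, hmt⟩ := exists_int_vector_near_multiple hv0
    (show 0 < δ / (2 * Real.pi) by positivity)
  obtain ⟨i, hi⟩ := Function.ne_iff.mp hm
  let w : Fin k → ℝ := fun i => 2 * Real.pi * m i
  have hmem (s : unitInterval) :
      torusExp ((s : ℝ) • w) • x ∈ φ.source ∩ φ ⁻¹' Metric.ball (φ x) r := by
    -- The first summand has norm below `δ`; the second lies on the line through `v`, whose
    -- exponential fixes `x`.
    have hw : (s : ℝ) • w = (s : ℝ) • (fun i => 2 * Real.pi * (m i - t * v i)) +
        (s * (2 * Real.pi) * t) • v := by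
      funext i
      simp only [w, Pi.smul_apply, Pi.add_apply, smul_eq_mul]
      ring
    rw [hw, torusExp_add, mul_smul, hv]
    refine hδφ ?_
    rw [mem_ball_zero_iff, pi_norm_lt_iff hδ]
    intro i
    have h1 := hmt i
    rw [lt_div_iff₀ (by positivity)] at h1
    have h2 : ‖((s : ℝ) • fun i => 2 * Real.pi * (m i - t * v i)) i‖ =
        s * (|m i - t * v i| * (2 * Real.pi)) := by
      rw [Pi.smul_apply, norm_smul, Real.norm_of_nonneg s.2.1, Real.norm_eq_abs, abs_mul,
        abs_of_pos (show 0 < 2 * Real.pi by positivity), mul_comm (2 * Real.pi)]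
    rw [h2]
    exact (mul_le_of_le_one_left (by positivity) s.2.2).trans_lt h1
  have h1w : torusExp w = 1 := by
    funext i
    simp only [torusExp, w, Pi.one_apply]
    rw [Circle.exp_eq_one]
    exact ⟨m i, by ring⟩
  let γ : Path x x :=
    { toFun := fun s => torusExp ((s : ℝ) • w) • x
      continuous_toFun := hcont.comp (by fun_prop)
      source' := by simp
      target' := by simp [h1w] }
  obtain ⟨c, hc, hcm⟩ := exists_isCocycle_winding (TopCat.ofHom (orbitMap k x)) hx i
  -- In the chart the loop lies in a ball, hence contracts there.
  have h1 : c (TopCat.simplexOfPath (X := TopCat.of M) γ) = 0 := by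
    let x' : Metric.ball (φ x) r := ⟨φ x, Metric.mem_ball_self hr⟩
    let γ' : Path x' x' :=
      { toFun := fun s => ⟨φ (γ s), (hmem s).2⟩
        continuous_toFun := by
          refine Continuous.subtype_mk ?_ _
          exact φ.continuousOn.comp_continuous γ.continuous fun s => (hmem s).1
        source' := Subtype.ext (by simp [x'])
        target' := Subtype.ext (by simp [x']) }
    have : ContractibleSpace (Metric.ball (φ x) r) :=
      (convex_ball (φ x) r).contractibleSpace ⟨_, x'.2⟩
    let ψ : C(Metric.ball (φ x) r, M) :=
      ⟨fun y => φ.symm y, φ.continuousOn_symm.comp_continuous continuous_subtype_val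
        fun y => hrφ y.2⟩
    have hγψ : TopCat.simplexOfPath (X := TopCat.of M) γ =
        TopCat.simplexOfPath (X := TopCat.of M) (γ'.map ψ.continuous) := by
      rw [TopCat.simplexOfPath, TopCat.simplexOfPath]
      congr 1
      ext1 s
      exact (φ.left_inv (hmem _).1).symm
    rw [hγψ, TopCat.cocycle_simplexOfPath_eq_of_homotopic (X := TopCat.of M) hc
      ((SimplyConnectedSpace.paths_homotopic γ' (Path.refl x')).map ψ)]
    exact TopCat.cocycle_simplexOfPath_refl hc _
  -- The same loop is the orbit image of the lattice loop `m`, on which `c` takes the value `m i ≠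
  -- 0`.
  have h2 : (TopCat.toSSet.map (TopCat.ofHom (orbitMap k x))).app _
      (pathSimplex.{u} fun _ : Fin 1 => m) = TopCat.simplexOfPath (X := TopCat.of M) γ := by
    rw [pathSimplex, affineSimplex, TopCat.toSSet_map_app_singularSimplex, TopCat.simplexOfPath]
    congr 1
    ext1 s
    change (affineMap.{u} (k := k) _ s).down • x = torusExp (k := k) (s 1 • w) • x
    congr 1
    funext i
    simp [affineMap, torusExp, w, Fin.sum_univ_two]
    ring_nf
  have h3 := hcm fun _ => m
  rw [h2, h1] at h3
  exact hi (by exact_mod_cast h3.symm)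

end

end TorusAction

end

theorem corollary2p3 {k n : ℕ} {M : Type u} [TopologicalSpace M] [T2Space M] [CompactSpace M]
    [ChartedSpace (EuclideanSpace ℝ (Fin n)) M] [IsManifold (𝓡 n) ∞ M]
    [MulAction (TorusAction.Torus k) M] [ContinuousSMul (TorusAction.Torus k) M]
    [ContMDiffSMul (TorusAction.torusModel k) (𝓡 n) ∞ (TorusAction.Torus k) M]
    (x : M) (hx : TorusAction.HomologicallyInjectiveAt k x) :
    (∀ j : ℕ, (Nat.choose k j : Cardinal.{u}) ≤ TorusAction.bettiNumber M j) ∧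
      ((2 ^ k : ℕ) : Cardinal.{u}) ≤ ∑ j ∈ Finset.range (n + 1), TorusAction.bettiNumber M j := by
  have hchoose := TorusAction.choose_le_bettiNumber (TorusAction.orbitMap k x) hx
  have hkn : k ≤ n := hx.le_dim
  refine ⟨hchoose, ?_⟩
  -- By `hkn` the range contains every `j ≤ k`, so no binomial coefficient is lost.
  have hsum : 2 ^ k ≤ ∑ j ∈ Finset.range (n + 1), Nat.choose k j := by
    rw [← Nat.sum_range_choose]
    exact Finset.sum_le_sum_of_subset (Finset.range_mono (by omega))
  calc ((2 ^ k : ℕ) : Cardinal.{u})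
      ≤ ((∑ j ∈ Finset.range (n + 1), Nat.choose k j : ℕ) : Cardinal.{u}) := by exact_mod_cast hsum
    _ = ∑ j ∈ Finset.range (n + 1), (Nat.choose k j : Cardinal.{u}) := by push_cast; rfl
    _ ≤ _ := Finset.sum_le_sum fun j _ => hchoose j
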